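/- **Values.** Let $X$ be a set of labels. Causal terms over $X$ are built from labels by products $\prod S$ and sums $\sum S$ of arbitrary (possibly empty or infinite) families of terms, a binary application $t\cdot u$, and a unary negation ${\sim}t$; write $1=\prod\emptyset$, $0=\sum\emptyset$, $t*u$ and $t+u$ for binary products and sums. An elementary term is $l$, ${\sim}l$ or ${\sim}{\sim}l$ with $l\in X$. The set $\mathbf V_X$ of causal values is the set of terms modulo the congruence generated by the axioms of a completely distributive complete lattice with meet $*$ and join $+$, together with - $t\cdot(u\cdot w)=(t\cdot u)\cdot w$; $\;t=t+u\cdot t\cdot w$; $\;u\cdot t\cdot w=t*(u\cdot t\cdot w)$; $\;t=1\cdot t=t\cdot 1$; $\;0=t\cdot 0=0\cdot t$; $\;x\cdot x=x$ for $x$ elementary; application distributes over arbitrary sums on both sides; - for terms $c,d,e$ without sums (in negation normal form): $c\cdot d\cdot e=(c\cdot d)*(d\cdot e)$ if $d\neq 1$, and application distributes over arbitrary non-empty products of such terms, $c\cdot\prod_i d_i=\prod_i(c\cdot d_i)$, $(\prod_i d_i)\cdot e=\prod_i(d_i\cdot e)$; - $t*{\sim}t=0$; ${\sim}{\sim}{\sim}t={\sim}t$;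 ${\sim}(t+u)={\sim}t*{\sim}u$; ${\sim}(t*u)={\sim}t+{\sim}u$; ${\sim}t+{\sim}{\sim}t=1$; ${\sim}(t\cdot u)={\sim}(t*u)$. Provenance terms are built in the same way without application and with a negation $\neg$; the set $\mathbf B_X$ of provenance values is the set of provenance terms modulo the laws of a completely distributive Boolean algebra. The map $\lambda^p:\mathbf V_X\to\mathbf B_X$ replaces $\cdot$ by $*$ and ${\sim}$ by $\neg$ (it is well defined on values). In both algebras $\le$ denotes the lattice order. **Programs.** A labelled logic program over a signature $\langle At,Lb\rangle$ is a set of rules $r: H\leftarrow B_1,\dots,B_m,\mathit{not}\,C_1,\dots,\mathit{not}\,C_n$ with $r\in Lb$ or $r=1$, $H\in At$, and each $B_j,C_j$ an atom or a causal term over $Lb$; a fact is a rule with $m=n=0$. An interpretation $I:At\to\mathbf V_X$ (values of terms being their classes, $I(\mathit{not}\,C)={\sim}I(C)$) is a model of a set of rules if $(I(B_1)*\dots*I(B_m)*I(\mathit{not}\,C_1)*\dots*I(\mathit{not}\,C_n))\cdot r\le I(H)$ for every rule. The reduct $P^J$ replaces each $\mathit{not}\,C_j$ by the value $J(\mathit{not}\,C_j)$,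 and $\Gamma_P(J)$ is the least model of $P^J$. With $\mathbb L_P$ the least fixpoint of $\Gamma_P^2$ and $\mathbb U_P=\Gamma_P(\mathbb L_P)$, the causal well-founded model is $$\mathbb W_P(A)=\mathbb L_P(A),\qquad \mathbb W_P(\mathit{not}\,A)={\sim}\mathbb U_P(A),\qquad \mathbb W_P(\mathit{undef}\,A)={\sim}\mathbb W_P(A)*{\sim}\mathbb W_P(\mathit{not}\,A).$$ The same definitions are used for interpretations in $\mathbf B_X$, with $\neg$ instead of ${\sim}$ and $*$ instead of $\cdot$; there, a term in a rule body is read through $\lambda^p$. Write $\mathfrak G_Q$ for the resulting operator of a set $Q$ of rules. **Augmented programs.** Let $X=Lb\uplus\{not(A): A\in At\}$. Let $\mathfrak P=P\cup\{({\sim}not(A):A)\;:\;A\in At \text{ is not a fact of } P\}$, evaluated in $\mathbf V_X$, and $\mathcal P=P\cup\{(\neg not(A):A)\;:\;A\in At \text{ is not a fact of } P\}$, evaluated in $\mathbf B_X$. Let $\mathfrak L$ be the least fixpoint of $\mathfrak G_{\mathcal P}^2$ and $\mathfrak U=\mathfrak G_{\mathcal P}(\mathfrak L)$. The why-not provenance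 of Damásio et al. is $$Why_{\mathcal P}(A)=\mathfrak L(A),\qquad Why_{\mathcal P}(\mathit{not}\,A)=\neg\mathfrak U(A),\qquad Why_{\mathcal P}(\mathit{undef}\,A)=\neg\mathfrak L(A)*\mathfrak U(A).$$ **Theorem.** Let $P$ be a program over a finite signature $\langle At,Lb\rangle$. Then the causal well-founded model $\mathbb W_{\mathfrak P}$ and the why-not provenance $Why_{\mathcal P}$ exist and are unique, and for every q-literal $L$ (that is, $L=A$, $\mathit{not}\,A$ or $\mathit{undef}\,A$ with $A\in At$) $$\lambda^p\big(\mathbb W_{\mathfrak P}(L)\big)=Why_{\mathcal P}(L).$$ -/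

import Mathlib

universe u

namespace ECJ

/- ## Causal terms and causal values -/

/-- Causal terms over the labels `Lb`; sums and products range over arbitrary small families. -/
inductive Term (Lb : Type u) : Type (u + 1)
  | label (l : Lb) : Term Lb
  | prod {ι : Type u} (f : ι → Term Lb) : Term Lb
  | sum {ι : Type u} (f : ι → Term Lb) : Term Lb
  | app (t u : Term Lb) : Term Lb
  | neg (t : Term Lb) : Term Lb

namespace Term

variable {Lb : Type u}

/-- The empty product. -/
def one : Term Lb := prod (PEmpty.elim : PEmpty.{u + 1} → Term Lb)

/-- The empty sum. -/
def zero : Term Lb := sum (PEmpty.elim : PEmpty.{u + 1} → Term Lb)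

/-- The binary product `t * u`. -/
def mul (t u : Term Lb) : Term Lb := prod fun b : ULift.{u} Bool => cond b.down t u

/-- The binary sum `t + u`. -/
def add (t u : Term Lb) : Term Lb := sum fun b : ULift.{u} Bool => cond b.down t u

/-- Renaming of labels. -/
def map {Lb' : Type u} (g : Lb → Lb') : Term Lb → Term Lb'
  | label l => label (g l)
  | prod f => prod fun i => (f i).map g
  | sum f => sum fun i => (f i).map g
  | app t u => app (t.map g) (u.map g)
  | neg t => neg (t.map g)

/-- Elementary terms: a label, a negated label or a doubly negated label. -/
inductive Elementary : Term Lb → Prop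
  | label (l : Lb) : Elementary (label l)
  | neg (l : Lb) : Elementary (neg (label l))
  | negNeg (l : Lb) : Elementary (neg (neg (label l)))

/-- Terms without sums, in negation normal form (a negated product is a sum in disguise). -/
inductive SumFree : Term Lb → Prop
  | elementary {x : Term Lb} : Elementary x → SumFree x
  | prod {ι : Type u} {f : ι → Term Lb} : (∀ i, SumFree (f i)) → SumFree (prod f)
  | app {c d : Term Lb} : SumFree c → SumFree d → SumFree (app c d)

/-- Some label occurs in the term. For the terms in `SumFree` this says that
the term does not denote `1`. -/
def HasLabel : Term Lb → Prop
  | label _ => True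
  | prod f => ∃ i, (f i).HasLabel
  | sum f => ∃ i, (f i).HasLabel
  | app t u => t.HasLabel ∨ u.HasLabel
  | neg t => t.HasLabel

/-- The equations for application and for the pseudo-complement. -/
inductive Ax : Term Lb → Term Lb → Prop
  -- application
  | app_assoc (t u w : Term Lb) : Ax (app t (app u w)) (app (app t u) w)
  | add_absorb (t u w : Term Lb) : Ax t (add t (app (app u t) w))
  | mul_absorb (t u w : Term Lb) : Ax (app (app u t) w) (mul t (app (app u t) w))
  | one_app (t : Term Lb) : Ax t (app one t)
  | app_one (t : Term Lb) : Ax t (app t one)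
  | app_zero (t : Term Lb) : Ax zero (app t zero)
  | zero_app (t : Term Lb) : Ax zero (app zero t)
  | app_idem {x : Term Lb} : Elementary x → Ax (app x x) x
  | app_sum (t : Term Lb) {ι : Type u} (f : ι → Term Lb) :
      Ax (app t (sum f)) (sum fun i => app t (f i))
  | sum_app {ι : Type u} (f : ι → Term Lb) (t : Term Lb) :
      Ax (app (sum f) t) (sum fun i => app (f i) t)
  | app_app {c d e : Term Lb} : SumFree c → SumFree d → SumFree e → HasLabel d →
      Ax (app (app c d) e) (mul (app c d) (app d e))
  | app_prod {c : Term Lb} {ι : Type u} [Nonempty ι] {f : ι → Term Lb} :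
      SumFree c → (∀ i, SumFree (f i)) → Ax (app c (prod f)) (prod fun i => app c (f i))
  | prod_app {ι : Type u} [Nonempty ι] {f : ι → Term Lb} {e : Term Lb} :
      (∀ i, SumFree (f i)) → SumFree e → Ax (app (prod f) e) (prod fun i => app (f i) e)
  -- pseudo-complement
  | mul_neg (t : Term Lb) : Ax (mul t (neg t)) zero
  | neg_neg_neg (t : Term Lb) : Ax (neg (neg (neg t))) (neg t)
  | neg_add (t u : Term Lb) : Ax (neg (add t u)) (mul (neg t) (neg u))
  | neg_mul (t u : Term Lb) : Ax (neg (mul t u)) (add (neg t) (neg u))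
  | weak_em (t : Term Lb) : Ax (add (neg t) (neg (neg t))) one
  | neg_app (t u : Term Lb) : Ax (neg (app t u)) (neg (mul t u))

/-- The order on terms derived from the axioms: products are meets, sums are joins, the lattice is
completely distributive, the operations respect the order, and the equations `Ax` hold. -/
inductive Le : Term Lb → Term Lb → Prop
  | refl (t : Term Lb) : Le t t
  | trans {t u w : Term Lb} : Le t u → Le u w → Le t w
  | prod_le {ι : Type u} (f : ι → Term Lb) (i : ι) : Le (prod f) (f i)
  | le_prod {ι : Type u} {f : ι → Term Lb} {t : Term Lb} : (∀ i, Le t (f i)) → Le t (prod f)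
  | le_sum {ι : Type u} (f : ι → Term Lb) (i : ι) : Le (f i) (sum f)
  | sum_le {ι : Type u} {f : ι → Term Lb} {t : Term Lb} : (∀ i, Le (f i) t) → Le (sum f) t
  | distrib {ι : Type u} {κ : ι → Type u} (f : (i : ι) → κ i → Term Lb) :
      Le (prod fun i => sum (f i)) (sum fun g : (i : ι) → κ i => prod fun i => f i (g i))
  | app_mono {t t' u u' : Term Lb} : Le t t' → Le u u' → Le (app t u) (app t' u')
  | neg_anti {t u : Term Lb} : Le t u → Le (neg u) (neg t)
  | ax {t u : Term Lb} : Ax t u → Le t u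
  | ax_symm {t u : Term Lb} : Ax t u → Le u t

instance : Preorder (Term Lb) where
  le := Le
  le_refl := Le.refl
  le_trans _ _ _ := Le.trans

theorem mul_le_left (t u : Term Lb) : mul t u ≤ t :=
  Le.prod_le (fun b : ULift.{u} Bool => cond b.down t u) ⟨true⟩

theorem mul_le_right (t u : Term Lb) : mul t u ≤ u :=
  Le.prod_le (fun b : ULift.{u} Bool => cond b.down t u) ⟨false⟩

theorem le_mul {t u w : Term Lb} (h : w ≤ t) (k : w ≤ u) : w ≤ mul t u :=
  Le.le_prod (by rintro ⟨_ | _⟩ <;> assumption)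

theorem le_add_left (t u : Term Lb) : t ≤ add t u :=
  Le.le_sum (fun b : ULift.{u} Bool => cond b.down t u) ⟨true⟩

theorem le_add_right (t u : Term Lb) : u ≤ add t u :=
  Le.le_sum (fun b : ULift.{u} Bool => cond b.down t u) ⟨false⟩

theorem add_le {t u w : Term Lb} (h : t ≤ w) (k : u ≤ w) : add t u ≤ w :=
  Le.sum_le (by rintro ⟨_ | _⟩ <;> assumption)

theorem le_one (t : Term Lb) : t ≤ one := Le.le_prod (fun i => PEmpty.elim i)

theorem zero_le (t : Term Lb) : zero ≤ t := Le.sum_le (fun i => PEmpty.elim i)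

end Term

/-- Causal values: classes of causal terms modulo the axioms, with the induced order. -/
abbrev Value (Lb : Type u) : Type (u + 1) := Antisymmetrization (Term Lb) (· ≤ ·)

namespace Value

variable {Lb : Type u}

/-- The causal value denoted by a term. -/
def mk (t : Term Lb) : Value Lb := toAntisymmetrization (· ≤ ·) t

/-- Meet is the product `*`, join is the sum `+`. -/
instance : Lattice (Value Lb) where
  inf := Quotient.map₂ Term.mul fun _ _ h _ _ k =>
    ⟨Term.le_mul ((Term.mul_le_left _ _).trans h.1) ((Term.mul_le_right _ _).trans k.1),
      Term.le_mul ((Term.mul_le_left _ _).trans h.2) ((Term.mul_le_right _ _).trans k.2)⟩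
  sup := Quotient.map₂ Term.add fun _ _ h _ _ k =>
    ⟨Term.add_le (h.1.trans (Term.le_add_left _ _)) (k.1.trans (Term.le_add_right _ _)),
      Term.add_le (h.2.trans (Term.le_add_left _ _)) (k.2.trans (Term.le_add_right _ _))⟩
  inf_le_left := by rintro ⟨a⟩ ⟨b⟩; exact Term.mul_le_left a b
  inf_le_right := by rintro ⟨a⟩ ⟨b⟩; exact Term.mul_le_right a b
  le_inf := by
    rintro ⟨a⟩ ⟨b⟩ ⟨c⟩ h k
    exact Term.le_mul (show a ≤ b from h) (show a ≤ c from k)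
  le_sup_left := by rintro ⟨a⟩ ⟨b⟩; exact Term.le_add_left a b
  le_sup_right := by rintro ⟨a⟩ ⟨b⟩; exact Term.le_add_right a b
  sup_le := by
    rintro ⟨a⟩ ⟨b⟩ ⟨c⟩ h k
    exact Term.add_le (show a ≤ c from h) (show b ≤ c from k)

instance : BoundedOrder (Value Lb) where
  top := mk .one
  bot := mk .zero
  le_top := by rintro ⟨a⟩; exact Term.le_one a
  bot_le := by rintro ⟨a⟩; exact Term.zero_le a

/-- The pseudo-complement on causal values. -/
instance : Compl (Value Lb) where
  compl := Quotient.map Term.neg fun _ _ h => ⟨.neg_anti h.2, .neg_anti h.1⟩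

/-- The application `·` on causal values. -/
def app : Value Lb → Value Lb → Value Lb :=
  Quotient.map₂ Term.app fun _ _ h _ _ k => ⟨.app_mono h.1 k.1, .app_mono h.2 k.2⟩

end Value

/- ## Provenance terms and provenance values -/

/-- Provenance terms over the labels `Lb`. -/
inductive PTerm (Lb : Type u) : Type (u + 1)
  | label (l : Lb) : PTerm Lb
  | prod {ι : Type u} (f : ι → PTerm Lb) : PTerm Lb
  | sum {ι : Type u} (f : ι → PTerm Lb) : PTerm Lb
  | neg (t : PTerm Lb) : PTerm Lb

namespace PTerm

variable {Lb : Type u}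

/-- The empty product. -/
def one : PTerm Lb := prod (PEmpty.elim : PEmpty.{u + 1} → PTerm Lb)

/-- The empty sum. -/
def zero : PTerm Lb := sum (PEmpty.elim : PEmpty.{u + 1} → PTerm Lb)

/-- The binary product `t * u`. -/
def mul (t u : PTerm Lb) : PTerm Lb := prod fun b : ULift.{u} Bool => cond b.down t u

/-- The binary sum `t + u`. -/
def add (t u : PTerm Lb) : PTerm Lb := sum fun b : ULift.{u} Bool => cond b.down t u

/-- The order on provenance terms derived from the axioms of a completely distributive
Boolean algebra. -/
inductive Le : PTerm Lb → PTerm Lb → Prop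
  | refl (t : PTerm Lb) : Le t t
  | trans {t u w : PTerm Lb} : Le t u → Le u w → Le t w
  | prod_le {ι : Type u} (f : ι → PTerm Lb) (i : ι) : Le (prod f) (f i)
  | le_prod {ι : Type u} {f : ι → PTerm Lb} {t : PTerm Lb} : (∀ i, Le t (f i)) → Le t (prod f)
  | le_sum {ι : Type u} (f : ι → PTerm Lb) (i : ι) : Le (f i) (sum f)
  | sum_le {ι : Type u} {f : ι → PTerm Lb} {t : PTerm Lb} : (∀ i, Le (f i) t) → Le (sum f) t
  | distrib {ι : Type u} {κ : ι → Type u} (f : (i : ι) → κ i → PTerm Lb) :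
      Le (prod fun i => sum (f i)) (sum fun g : (i : ι) → κ i => prod fun i => f i (g i))
  | neg_anti {t u : PTerm Lb} : Le t u → Le (neg u) (neg t)
  | mul_neg (t : PTerm Lb) : Le (mul t (neg t)) zero
  | add_neg (t : PTerm Lb) : Le one (add t (neg t))

instance : Preorder (PTerm Lb) where
  le := Le
  le_refl := Le.refl
  le_trans _ _ _ := Le.trans

theorem mul_le_left (t u : PTerm Lb) : mul t u ≤ t :=
  Le.prod_le (fun b : ULift.{u} Bool => cond b.down t u) ⟨true⟩

theorem mul_le_right (t u : PTerm Lb) : mul t u ≤ u :=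
  Le.prod_le (fun b : ULift.{u} Bool => cond b.down t u) ⟨false⟩

theorem le_mul {t u w : PTerm Lb} (h : w ≤ t) (k : w ≤ u) : w ≤ mul t u :=
  Le.le_prod (by rintro ⟨_ | _⟩ <;> assumption)

theorem le_add_left (t u : PTerm Lb) : t ≤ add t u :=
  Le.le_sum (fun b : ULift.{u} Bool => cond b.down t u) ⟨true⟩

theorem le_add_right (t u : PTerm Lb) : u ≤ add t u :=
  Le.le_sum (fun b : ULift.{u} Bool => cond b.down t u) ⟨false⟩

theorem add_le {t u w : PTerm Lb} (h : t ≤ w) (k : u ≤ w) : add t u ≤ w :=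
  Le.sum_le (by rintro ⟨_ | _⟩ <;> assumption)

theorem le_one (t : PTerm Lb) : t ≤ one := Le.le_prod (fun i => PEmpty.elim i)

theorem zero_le (t : PTerm Lb) : zero ≤ t := Le.sum_le (fun i => PEmpty.elim i)

end PTerm

/-- Provenance values: classes of provenance terms modulo the equivalences of Boolean algebra. -/
abbrev PValue (Lb : Type u) : Type (u + 1) := Antisymmetrization (PTerm Lb) (· ≤ ·)

namespace PValue

variable {Lb : Type u}

/-- The provenance value denoted by a provenance term. -/
def mk (t : PTerm Lb) : PValue Lb := toAntisymmetrization (· ≤ ·) t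

/-- Meet is the product `*`, join is the sum `+`. -/
instance : Lattice (PValue Lb) where
  inf := Quotient.map₂ PTerm.mul fun _ _ h _ _ k =>
    ⟨PTerm.le_mul ((PTerm.mul_le_left _ _).trans h.1) ((PTerm.mul_le_right _ _).trans k.1),
      PTerm.le_mul ((PTerm.mul_le_left _ _).trans h.2) ((PTerm.mul_le_right _ _).trans k.2)⟩
  sup := Quotient.map₂ PTerm.add fun _ _ h _ _ k =>
    ⟨PTerm.add_le (h.1.trans (PTerm.le_add_left _ _)) (k.1.trans (PTerm.le_add_right _ _)),
      PTerm.add_le (h.2.trans (PTerm.le_add_left _ _)) (k.2.trans (PTerm.le_add_right _ _))⟩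
  inf_le_left := by rintro ⟨a⟩ ⟨b⟩; exact PTerm.mul_le_left a b
  inf_le_right := by rintro ⟨a⟩ ⟨b⟩; exact PTerm.mul_le_right a b
  le_inf := by
    rintro ⟨a⟩ ⟨b⟩ ⟨c⟩ h k
    exact PTerm.le_mul (show a ≤ b from h) (show a ≤ c from k)
  le_sup_left := by rintro ⟨a⟩ ⟨b⟩; exact PTerm.le_add_left a b
  le_sup_right := by rintro ⟨a⟩ ⟨b⟩; exact PTerm.le_add_right a b
  sup_le := by
    rintro ⟨a⟩ ⟨b⟩ ⟨c⟩ h k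
    exact PTerm.add_le (show a ≤ c from h) (show b ≤ c from k)

theorem isGLB_prod {ι : Type u} (f : ι → PTerm Lb) :
    IsGLB (Set.range fun i => mk (f i)) (mk (.prod f)) := by
  constructor
  · rintro _ ⟨i, rfl⟩; exact PTerm.Le.prod_le f i
  · rintro ⟨t⟩ h; exact PTerm.Le.le_prod fun i => h ⟨i, rfl⟩

theorem isLUB_sum {ι : Type u} (f : ι → PTerm Lb) :
    IsLUB (Set.range fun i => mk (f i)) (mk (.sum f)) := by
  constructor
  · rintro _ ⟨i, rfl⟩; exact PTerm.Le.le_sum f i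
  · rintro ⟨t⟩ h; exact PTerm.Le.sum_le fun i => h ⟨i, rfl⟩

instance : DistribLattice (PValue Lb) :=
  DistribLattice.ofInfSupLe (by
    rintro ⟨a⟩ ⟨b⟩ ⟨c⟩
    let F : ULift.{u} Bool → ULift.{u} Bool → PTerm Lb :=
      fun i j => cond i.down a (cond j.down b c)
    have h : (PTerm.prod fun i => .sum (F i)) ≤ .sum fun g : (i : ULift.{u} Bool) → ULift.{u} Bool =>
        .prod fun i => F i (g i) :=
      PTerm.Le.distrib F
    have h1 : PTerm.mul a (PTerm.add b c) ≤ .prod fun i => .sum (F i) := by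
      refine PTerm.Le.le_prod ?_
      rintro ⟨_ | _⟩
      · exact PTerm.mul_le_right _ _
      · exact PTerm.Le.trans (PTerm.mul_le_left _ _) (PTerm.Le.le_sum (F ⟨true⟩) ⟨true⟩)
    have h2 : (PTerm.sum fun g : (i : ULift.{u} Bool) → ULift.{u} Bool => .prod fun i => F i (g i)) ≤
        PTerm.add (PTerm.mul a b) (PTerm.mul a c) := by
      refine PTerm.Le.sum_le fun g => ?_
      have ha : (PTerm.prod fun i => F i (g i)) ≤ a :=
        PTerm.Le.prod_le (fun i => F i (g i)) ⟨true⟩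
      have hb : (PTerm.prod fun i => F i (g i)) ≤ cond (g ⟨false⟩).down b c :=
        PTerm.Le.prod_le (fun i => F i (g i)) ⟨false⟩
      rcases hg : (g ⟨false⟩).down with _ | _ <;> rw [hg] at hb
      · exact (PTerm.le_mul ha hb).trans (PTerm.le_add_right _ _)
      · exact (PTerm.le_mul ha hb).trans (PTerm.le_add_left _ _)
    exact (h1.trans h).trans h2)

/-- Provenance values form a Boolean algebra. -/
instance : BooleanAlgebra (PValue Lb) where
  top := mk .one
  bot := mk .zero
  le_top := by rintro ⟨a⟩; exact PTerm.le_one a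
  bot_le := by rintro ⟨a⟩; exact PTerm.zero_le a
  compl := Quotient.map PTerm.neg fun _ _ h => ⟨.neg_anti h.2, .neg_anti h.1⟩
  inf_compl_le_bot := by rintro ⟨a⟩; exact show PTerm.mul a (.neg a) ≤ .zero from PTerm.Le.mul_neg a
  top_le_sup_compl := by rintro ⟨a⟩; exact show PTerm.one ≤ .add a (.neg a) from PTerm.Le.add_neg a

end PValue

/- ## The map from causal values to provenance values -/

namespace Term

variable {Lb : Type u}

/-- Replace application by product and the pseudo-complement by Boolean negation. -/
def toP : Term Lb → PTerm Lb
  | label l => .label l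
  | prod f => .prod fun i => (f i).toP
  | sum f => .sum fun i => (f i).toP
  | app t u => .mul t.toP u.toP
  | neg t => .neg t.toP

/-- The provenance value of the flattened term. -/
def pv (t : Term Lb) : PValue Lb := PValue.mk t.toP

theorem pv_app (t u : Term Lb) : (app t u).pv = t.pv ⊓ u.pv := rfl

theorem pv_neg (t : Term Lb) : (neg t).pv = t.pvᶜ := rfl

theorem isGLB_pv_prod {ι : Type u} (f : ι → Term Lb) :
    IsGLB (Set.range fun i => (f i).pv) (prod f).pv := PValue.isGLB_prod _

theorem isLUB_pv_sum {ι : Type u} (f : ι → Term Lb) :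
    IsLUB (Set.range fun i => (f i).pv) (sum f).pv := PValue.isLUB_sum _

theorem pv_prod_le {ι : Type u} (f : ι → Term Lb) (i : ι) : (prod f).pv ≤ (f i).pv :=
  (isGLB_pv_prod f).1 ⟨i, rfl⟩

theorem le_pv_prod {ι : Type u} {f : ι → Term Lb} {a : PValue Lb} (h : ∀ i, a ≤ (f i).pv) :
    a ≤ (prod f).pv := (isGLB_pv_prod f).2 (by rintro _ ⟨i, rfl⟩; exact h i)

theorem le_pv_sum {ι : Type u} (f : ι → Term Lb) (i : ι) : (f i).pv ≤ (sum f).pv :=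
  (isLUB_pv_sum f).1 ⟨i, rfl⟩

theorem pv_sum_le {ι : Type u} {f : ι → Term Lb} {a : PValue Lb} (h : ∀ i, (f i).pv ≤ a) :
    (sum f).pv ≤ a := (isLUB_pv_sum f).2 (by rintro _ ⟨i, rfl⟩; exact h i)

theorem pv_mul (t u : Term Lb) : (mul t u).pv = t.pv ⊓ u.pv :=
  le_antisymm
    (le_inf (pv_prod_le (fun b : ULift.{u} Bool => cond b.down t u) ⟨true⟩)
      (pv_prod_le (fun b : ULift.{u} Bool => cond b.down t u) ⟨false⟩))
    (le_pv_prod fun | ⟨true⟩ => inf_le_left | ⟨false⟩ => inf_le_right)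

theorem pv_add (t u : Term Lb) : (add t u).pv = t.pv ⊔ u.pv :=
  le_antisymm (pv_sum_le fun | ⟨true⟩ => le_sup_left | ⟨false⟩ => le_sup_right)
    (sup_le (le_pv_sum (fun b : ULift.{u} Bool => cond b.down t u) ⟨true⟩)
      (le_pv_sum (fun b : ULift.{u} Bool => cond b.down t u) ⟨false⟩))

theorem pv_one : (one : Term Lb).pv = ⊤ := top_le_iff.1 (le_pv_prod fun i => i.elim)

theorem pv_zero : (zero : Term Lb).pv = ⊥ := le_bot_iff.1 (pv_sum_le fun i => i.elim)

theorem pv_app_sum (t : Term Lb) {ι : Type u} (f : ι → Term Lb) :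
    t.pv ⊓ (sum f).pv = (sum fun i => app t (f i)).pv := by
  apply le_antisymm
  · rw [inf_comm, ← le_himp_iff]
    exact pv_sum_le fun i => le_himp_iff.2
      (inf_comm (t.pv) _ ▸ le_pv_sum (fun i => app t (f i)) i)
  · exact pv_sum_le fun i => inf_le_inf_left _ (le_pv_sum f i)

theorem pv_app_prod (t : Term Lb) {ι : Type u} [Nonempty ι] (f : ι → Term Lb) :
    t.pv ⊓ (prod f).pv = (prod fun i => app t (f i)).pv := by
  apply le_antisymm
  · exact le_pv_prod fun i => inf_le_inf_left _ (pv_prod_le f i)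
  · have h (i : ι) : (prod fun i => app t (f i)).pv ≤ t.pv ⊓ (f i).pv := pv_prod_le _ i
    exact le_inf ((h (Classical.arbitrary ι)).trans inf_le_left)
      (le_pv_prod fun i => (h i).trans inf_le_right)

theorem Ax.pv_eq {t u : Term Lb} (h : Ax t u) : t.pv = u.pv := by
  cases h with
  | app_assoc t u w => simp only [pv_app, inf_assoc]
  | add_absorb t u w =>
    rw [pv_add, pv_app, pv_app]
    exact (sup_eq_left.2 (inf_le_left.trans inf_le_right)).symm
  | mul_absorb t u w =>
    rw [pv_mul, pv_app, pv_app]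
    exact (inf_eq_right.2 (inf_le_left.trans inf_le_right)).symm
  | one_app => simp only [pv_app, pv_one, top_inf_eq]
  | app_one => simp only [pv_app, pv_one, inf_top_eq]
  | app_zero => simp only [pv_app, pv_zero, inf_bot_eq]
  | zero_app => simp only [pv_app, pv_zero, bot_inf_eq]
  | app_idem _ => simp only [pv_app, inf_idem]
  | app_sum t f => rw [pv_app, pv_app_sum]
  | sum_app f t =>
    rw [pv_app, inf_comm, pv_app_sum]
    exact le_antisymm
      (pv_sum_le fun i => by rw [pv_app, inf_comm]; exact le_pv_sum (fun i => app (f i) t) i)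
      (pv_sum_le fun i => by rw [pv_app, inf_comm]; exact le_pv_sum (fun i => app t (f i)) i)
  | @app_app c d e _ _ _ _ =>
    simp only [pv_app, pv_mul]
    rw [inf_assoc c.pv d.pv (d.pv ⊓ e.pv), ← inf_assoc d.pv d.pv, inf_idem, inf_assoc]
  | @app_prod c ι _ f _ _ => rw [pv_app, pv_app_prod]
  | @prod_app ι _ f e _ _ =>
    rw [pv_app, inf_comm, pv_app_prod]
    exact le_antisymm
      (le_pv_prod fun i => by rw [pv_app, inf_comm]; exact pv_prod_le (fun i => app e (f i)) i)
      (le_pv_prod fun i => by rw [pv_app, inf_comm]; exact pv_prod_le (fun i => app (f i) e) i)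
  | mul_neg t => simp only [pv_mul, pv_neg, pv_zero, inf_compl_eq_bot]
  | neg_neg_neg t => simp only [pv_neg, compl_compl]
  | neg_add t u => simp only [pv_neg, pv_add, pv_mul, compl_sup]
  | neg_mul t u => simp only [pv_neg, pv_add, pv_mul, compl_inf]
  | weak_em t => simp only [pv_neg, pv_add, pv_one, sup_compl_eq_top]
  | neg_app t u => simp only [pv_neg, pv_app, pv_mul]

theorem Le.pv_le {t u : Term Lb} (h : Le t u) : t.pv ≤ u.pv := by
  induction h with
  | refl => exact le_rfl
  | trans _ _ h k => exact h.trans k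
  | prod_le f i => exact pv_prod_le f i
  | le_prod _ h => exact le_pv_prod h
  | le_sum f i => exact le_pv_sum f i
  | sum_le _ h => exact pv_sum_le h
  | distrib f => exact PTerm.Le.distrib fun i j => (f i j).toP
  | app_mono _ _ h k => exact inf_le_inf h k
  | neg_anti _ h => exact compl_le_compl h
  | ax h => exact h.pv_eq.le
  | ax_symm h => exact h.pv_eq.ge

end Term

/-- The map `λ^p` from causal values to provenance values. -/
def lambdaP {Lb : Type u} : Value Lb → PValue Lb :=
  Quotient.lift Term.pv fun _ _ h => le_antisymm (Term.Le.pv_le h.1) (Term.Le.pv_le h.2)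

/- ## Labelled logic programs -/

/-- A rule `label : head ← pos, not neg`, with labels in `R`, whose body consists of atoms and of
constants in `T`, each possibly under default negation. -/
structure Rule (At R T : Type*) where
  label : R
  head : At
  pos : List (At ⊕ T)
  neg : List (At ⊕ T)

/-- A rule without body. -/
def Rule.IsFact {At R T : Type*} (r : Rule At R T) : Prop := r.pos = [] ∧ r.neg = []

/-- Change labels and constants of a rule. -/
def Rule.map {At R T R' T' : Type*} (f : R → R') (g : T → T') (r : Rule At R T) :
    Rule At R' T' where
  label := f r.label
  head := r.head
  pos := r.pos.map (Sum.map id g)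
  neg := r.neg.map (Sum.map id g)

/-- A labelled logic program over the atoms `At` and the labels `Lb`; an unlabelled rule has label
`none`, which stands for `1`. Body elements are atoms or causal terms. -/
abbrev Program (At Lb : Type u) := Set (Rule At (Option Lb) (Term Lb))

/-- Query literals. -/
inductive QLit (At : Type u) : Type u
  | atom (A : At) : QLit At
  | not (A : At) : QLit At
  | undef (A : At) : QLit At

/- ## Models, reducts and the alternating fixpoint

`V` is the algebra of values; `step` combines the value of a body with the label of the rule. -/

section Semantics

variable {At V : Type*} [Lattice V] [OrderTop V] [Compl V]

/-- The value of an atom or of a constant. -/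
def litValue (I : At → V) : At ⊕ V → V := Sum.elim I id

/-- The product of the values of the body literals. -/
def bodyValue (I : At → V) (r : Rule At V V) : V :=
  (r.pos.map (litValue I)).foldr (· ⊓ ·) ⊤ ⊓
    (r.neg.map fun c => (litValue I c)ᶜ).foldr (· ⊓ ·) ⊤

/-- `I` satisfies every rule of `P`. -/
def IsModel (step : V → V → V) (P : Set (Rule At V V)) (I : At → V) : Prop :=
  ∀ r ∈ P, step (bodyValue I r) r.label ≤ I r.head

/-- The positive program obtained by evaluating the negative bodies in `J`. -/
def reduct (P : Set (Rule At V V)) (J : At → V) : Set (Rule At V V) :=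
  (fun r => { r with
    pos := r.pos ++ r.neg.map fun c => Sum.inr (litValue J c)ᶜ
    neg := [] }) '' P

/-- `G = Γ_P(J)`, that is, `G` is the least model of the reduct of `P` by `J`. -/
def IsGamma (step : V → V → V) (P : Set (Rule At V V)) (J G : At → V) : Prop :=
  IsLeast {I | IsModel step (reduct P J) I} G

/-- `L` is the least fixpoint of `Γ_P ∘ Γ_P`. -/
def IsLfpGammaSq (step : V → V → V) (P : Set (Rule At V V)) (L : At → V) : Prop :=
  IsLeast {I | ∃ J, IsGamma step P I J ∧ IsGamma step P J I} L

end Semantics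

/-- `W` is the causal well-founded model of `P`. -/
def IsCausalWFM {At Lb : Type u} (P : Set (Rule At (Value Lb) (Value Lb)))
    (W : QLit At → Value Lb) : Prop :=
  ∃ L U : At → Value Lb, IsLfpGammaSq Value.app P L ∧ IsGamma Value.app P L U ∧
    ∀ A : At, W (.atom A) = L A ∧ W (.not A) = (U A)ᶜ ∧
      W (.undef A) = (W (.atom A))ᶜ ⊓ (W (.not A))ᶜ

/- ## The augmented programs -/

/-- The labels `Lb` together with a fresh label `not(A)` for every atom `A`. -/
inductive XLabel (At Lb : Type u) : Type u
  | lab (l : Lb) : XLabel At Lb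
  | notFact (A : At) : XLabel At Lb

section Augmented

variable {At Lb : Type u}

/-- The atoms that occur as a fact in `P`. -/
def factAtoms (P : Program At Lb) : Set At := {A | ∃ r ∈ P, r.IsFact ∧ r.head = A}

/-- The augmented program `P ∪ {∼not(A) : A | A not a fact of P}` over causal values. -/
def causalAug (P : Program At Lb) :
    Set (Rule At (Value (XLabel At Lb)) (Value (XLabel At Lb))) :=
  Rule.map (fun r => r.elim ⊤ fun l => Value.mk (.label (.lab l)))
      (fun t => Value.mk (t.map .lab)) '' P ∪
    {r | r.IsFact ∧ r.head ∉ factAtoms P ∧ r.label = (Value.mk (.label (.notFact r.head)))ᶜ}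

/-- The why-not program `P ∪ {¬not(A) : A | A not a fact of P}` over provenance values. Constants
in bodies, if any, are read with Boolean operations. -/
def whyNotAug (P : Program At Lb) :
    Set (Rule At (PValue (XLabel At Lb)) (PValue (XLabel At Lb))) :=
  Rule.map (fun r => r.elim ⊤ fun l => PValue.mk (.label (.lab l)))
      (fun t => PValue.mk (t.map .lab).toP) '' P ∪
    {r | r.IsFact ∧ r.head ∉ factAtoms P ∧ r.label = (PValue.mk (.label (.notFact r.head)))ᶜ}

/-- `D` is the why-not provenance of the q-literals with respect to `P`. -/
def IsWhyNotProvenance (P : Program At Lb) (D : QLit At → PValue (XLabel At Lb)) : Prop :=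
  ∃ L U : At → PValue (XLabel At Lb),
    IsLfpGammaSq (· ⊓ ·) (whyNotAug P) L ∧ IsGamma (· ⊓ ·) (whyNotAug P) L U ∧
      ∀ A : At, D (.atom A) = L A ∧ D (.not A) = (U A)ᶜ ∧ D (.undef A) = (L A)ᶜ ⊓ U A

end Augmented

end ECJ

/-! Flattening by `lambdaP` turns application into meet and preserves finite meets and joins, both
bounds and negation, so it carries each causal rule to the corresponding provenance rule. What has
to be shown is that it also carries least models to least models and least fixpoints to least
fixpoints. For this a right adjoint `ρ` of `lambdaP` is enough: a model or a prefixpoint on the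
provenance side is pulled back along `ρ`, compared there with the least one, and the inequality is
moved back by adjunction.

The adjoint exists because there are only finitely many causal values (`Value.finite`): on a finite
lattice, preserving finite joins and bottom suffices (`exists_gc_lambdaP`). Finiteness rests on a
normal form (`Term.isGenSum`): every term over finitely many labels is a sum of products of
elementary terms and of applications of two elementary terms. It also makes the values a complete
lattice, so least models and the least fixpoint of the monotone operator `Γ²` exist.

The transfer results `IsGamma.lambdaP` and `IsLfpGammaSq.lambdaP` then yield the why-not provenance
from the causal model. For undefined atoms, the double negation left on the causal side cancels
after flattening. -/

namespace ECJ

/-! ### Normal forms of causal terms -/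

namespace Term

variable {X : Type u}

/-- The elementary terms, indexed by three copies of the labels. -/
def elem : X ⊕ X ⊕ X → Term X
  | .inl l => label l
  | .inr (.inl l) => neg (label l)
  | .inr (.inr l) => neg (neg (label l))

/-- The elementary terms and their binary applications. -/
def gen : (X ⊕ X ⊕ X) ⊕ (X ⊕ X ⊕ X) × (X ⊕ X ⊕ X) → Term X
  | .inl x => elem x
  | .inr (x, y) => app (elem x) (elem y)

/-- The product of a set of generators. -/
def genProd (S : Set ((X ⊕ X ⊕ X) ⊕ (X ⊕ X ⊕ X) × (X ⊕ X ⊕ X))) : Term X :=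
  prod fun i : S => gen i

theorem elementary_elem (x : X ⊕ X ⊕ X) : Elementary (elem x) := by
  rcases x with l | l | l <;> constructor

theorem hasLabel_elem (x : X ⊕ X ⊕ X) : HasLabel (elem x) := by
  rcases x with l | l | l <;> simp [elem, HasLabel]

theorem sumFree_elem (x : X ⊕ X ⊕ X) : SumFree (elem x) := .elementary (elementary_elem x)

theorem sumFree_gen (i : (X ⊕ X ⊕ X) ⊕ (X ⊕ X ⊕ X) × (X ⊕ X ⊕ X)) : SumFree (gen i) := by
  rcases i with x | ⟨x, y⟩
  · exact sumFree_elem x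
  · exact .app (sumFree_elem x) (sumFree_elem y)

theorem sumFree_genProd (S : Set ((X ⊕ X ⊕ X) ⊕ (X ⊕ X ⊕ X) × (X ⊕ X ⊕ X))) :
    SumFree (genProd S) := .prod fun i => sumFree_gen i.1

theorem prod_mono {ι : Type u} {f g : ι → Term X} (h : ∀ i, f i ≤ g i) : prod f ≤ prod g :=
  Le.le_prod fun i => (Le.prod_le f i).trans (h i)

theorem sum_mono {ι : Type u} {f g : ι → Term X} (h : ∀ i, f i ≤ g i) : sum f ≤ sum g :=
  Le.sum_le fun i => Le.trans (h i) (Le.le_sum g i)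

/-- The term is equivalent to a product of generators. -/
def IsGenProd (t : Term X) : Prop := ∃ S, t ≤ genProd S ∧ genProd S ≤ t

theorem IsGenProd.congr {t u : Term X} (h : IsGenProd t) (k : u ≤ t) (k' : t ≤ u) :
    IsGenProd u :=
  let ⟨S, h₁, h₂⟩ := h
  ⟨S, k.trans h₁, h₂.trans k'⟩

theorem isGenProd_gen (i : (X ⊕ X ⊕ X) ⊕ (X ⊕ X ⊕ X) × (X ⊕ X ⊕ X)) : IsGenProd (gen i) := by
  refine ⟨{i}, Le.le_prod ?_, Le.prod_le (fun j : ({i} : Set _) => gen j.1) ⟨i, rfl⟩⟩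
  rintro ⟨_, rfl⟩
  exact Le.refl _

/-- The generators of the factors are collected in the union of their index sets. -/
theorem IsGenProd.prod {ι : Type u} {f : ι → Term X} (h : ∀ i, IsGenProd (f i)) :
    IsGenProd (Term.prod f) := by
  choose S h₁ h₂ using h
  refine ⟨⋃ i, S i, Le.le_prod ?_, Le.le_prod fun i => ?_⟩
  · rintro ⟨j, hj⟩
    obtain ⟨i, hi⟩ := Set.mem_iUnion.1 hj
    exact (Le.prod_le f i).trans ((h₁ i).trans (Le.prod_le (fun j : S i => gen j.1) ⟨j, hi⟩))
  · refine Le.trans (Le.le_prod fun j => ?_) (h₂ i)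
    exact Le.prod_le (fun j : (⋃ i, S i : Set _) => gen j.1) ⟨j.1, Set.mem_iUnion.2 ⟨i, j.2⟩⟩

theorem IsGenProd.mul {t u : Term X} (h : IsGenProd t) (k : IsGenProd u) :
    IsGenProd (mul t u) :=
  IsGenProd.prod (by rintro ⟨_ | _⟩ <;> assumption)

/-- A chain x·y·z splits into (x·y)*(y·z), because the middle term is elementary and so carries a
label. Hence applications of length two suffice as generators. -/
theorem isGenProd_app_elem_gen (x : X ⊕ X ⊕ X)
    (j : (X ⊕ X ⊕ X) ⊕ (X ⊕ X ⊕ X) × (X ⊕ X ⊕ X)) : IsGenProd (app (elem x) (gen j)) := by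
  rcases j with y | ⟨y, z⟩
  · exact isGenProd_gen (.inr (x, y))
  · have h := Ax.app_app (sumFree_elem x) (sumFree_elem y) (sumFree_elem z) (hasLabel_elem y)
    have k := Ax.app_assoc (elem x) (elem y) (elem z)
    exact ((isGenProd_gen (.inr (x, y))).mul (isGenProd_gen (.inr (y, z)))).congr
      ((Le.ax k).trans (.ax h)) ((Le.ax_symm h).trans (.ax_symm k))

theorem isGenProd_app_gen_gen (i j : (X ⊕ X ⊕ X) ⊕ (X ⊕ X ⊕ X) × (X ⊕ X ⊕ X)) :
    IsGenProd (app (gen i) (gen j)) := by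
  rcases i with x | ⟨x, y⟩
  · exact isGenProd_app_elem_gen x j
  · have h := Ax.app_app (sumFree_elem x) (sumFree_elem y) (sumFree_gen j) (hasLabel_elem y)
    exact ((isGenProd_gen (.inr (x, y))).mul (isGenProd_app_elem_gen y j)).congr
      (Le.ax h) (Le.ax_symm h)

theorem SumFree.isGenProd {t : Term X} (h : SumFree t) : IsGenProd t := by
  induction h with
  | elementary h =>
    cases h with
    | label l => exact isGenProd_gen (.inl (.inl l))
    | neg l => exact isGenProd_gen (.inl (.inr (.inl l)))
    | negNeg l => exact isGenProd_gen (.inl (.inr (.inr l)))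
  | prod _ ih => exact .prod ih
  | @app c d _ _ hc hd =>
    obtain ⟨S, hS₁, hS₂⟩ := id hc
    obtain ⟨T, hT₁, hT₂⟩ := id hd
    -- Application distributes only over non-empty products. An empty index set denotes 1 and is
    -- removed by the unit laws.
    rcases S.eq_empty_or_nonempty with rfl | hS
    · have h : one ≤ c := Le.trans (Le.le_prod fun i => i.2.elim) hS₂
      exact hd.congr (Le.trans (Le.app_mono (le_one c) (Le.refl d)) (Le.ax_symm (.one_app d)))
        (Le.trans (Le.ax (.one_app d)) (Le.app_mono h (Le.refl d)))
    rcases T.eq_empty_or_nonempty with rfl | hT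
    · have h : one ≤ d := Le.trans (Le.le_prod fun i => i.2.elim) hT₂
      exact hc.congr (Le.trans (Le.app_mono (Le.refl c) (le_one d)) (Le.ax_symm (.app_one c)))
        (Le.trans (Le.ax (.app_one c)) (Le.app_mono (Le.refl c) h))
    have := hS.to_subtype
    have := hT.to_subtype
    have e₁ : Ax (Term.app (genProd S) (genProd T))
        (Term.prod fun i : S => Term.app (gen i.1) (genProd T)) :=
      .prod_app (fun i => sumFree_gen i.1) (sumFree_genProd T)
    have e₂ (i : S) : Ax (Term.app (gen i.1) (genProd T))
        (Term.prod fun j : T => Term.app (gen i.1) (gen j.1)) :=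
      .app_prod (sumFree_gen i.1) fun j => sumFree_gen j.1
    refine (IsGenProd.prod fun i : S => IsGenProd.prod fun j : T =>
      isGenProd_app_gen_gen i.1 j.1).congr ?_ ?_
    · exact (Le.app_mono hS₁ hT₁).trans ((Le.ax e₁).trans (prod_mono fun i => Le.ax (e₂ i)))
    · exact Le.trans (prod_mono fun i => Le.ax_symm (e₂ i))
        ((Le.ax_symm e₁).trans (Le.app_mono hS₂ hT₂))

/-- The term is the sum of the products of generators below it. -/
def IsGenSum (t : Term X) : Prop :=
  t ≤ sum fun S : {S // genProd S ≤ t} => genProd S.1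

/-- A form suited to closure proofs: the products of generators below the term decide every
inequality with the term on the left. -/
theorem isGenSum_iff {t : Term X} :
    IsGenSum t ↔ ∀ w, (∀ S, genProd S ≤ t → genProd S ≤ w) → t ≤ w :=
  ⟨fun h _ k => Le.trans h (Le.sum_le fun S => k S.1 S.2), fun h => h _ fun S hS =>
    Le.le_sum (fun S : {S // genProd S ≤ t} => genProd S.1) ⟨S, hS⟩⟩

theorem IsGenSum.congr {t u : Term X} (h : IsGenSum t) (k : u ≤ t) (k' : t ≤ u) :
    IsGenSum u :=
  isGenSum_iff.2 fun w hw => k.trans (isGenSum_iff.1 h w fun S hS => hw S (hS.trans k'))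

theorem SumFree.isGenSum {t : Term X} (h : SumFree t) : IsGenSum t :=
  let ⟨S, h₁, h₂⟩ := h.isGenProd
  isGenSum_iff.2 fun _ hw => h₁.trans (hw S h₂)

theorem IsGenSum.sum {ι : Type u} {f : ι → Term X} (h : ∀ i, IsGenSum (f i)) :
    IsGenSum (Term.sum f) :=
  isGenSum_iff.2 fun w hw => Le.sum_le fun i =>
    isGenSum_iff.1 (h i) w fun S hS => hw S (Le.trans hS (Le.le_sum f i))

theorem IsGenSum.add {t u : Term X} (h : IsGenSum t) (k : IsGenSum u) : IsGenSum (add t u) :=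
  IsGenSum.sum (by rintro ⟨_ | _⟩ <;> assumption)

theorem IsGenSum.prod {ι : Type u} {f : ι → Term X} (h : ∀ i, IsGenSum (f i)) :
    IsGenSum (Term.prod f) := by
  -- Complete distributivity turns the product of sums into a sum, over choice functions, of
  -- sum-free products.
  have k := Le.distrib fun i (S : {S // genProd S ≤ f i}) => genProd S.1
  exact (IsGenSum.sum fun g : (i : ι) → {S // genProd S ≤ f i} =>
    (SumFree.prod fun i => sumFree_genProd (g i).1).isGenSum).congr
      (Le.trans (prod_mono h) k) (Le.sum_le fun g => prod_mono fun i => (g i).2)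

theorem IsGenSum.app {t u : Term X} (h : IsGenSum t) (k : IsGenSum u) : IsGenSum (app t u) := by
  refine (IsGenSum.sum fun S : {S // genProd S ≤ t} => IsGenSum.sum fun T : {T // genProd T ≤ u} =>
    (SumFree.app (sumFree_genProd S.1) (sumFree_genProd T.1)).isGenSum).congr ?_
      (Le.sum_le fun S => Le.sum_le fun T => Le.app_mono S.2 T.2)
  exact Le.trans (Le.app_mono h k)
    (Le.trans (Le.ax (.sum_app _ _)) (sum_mono fun S => Le.ax (.app_sum _ _)))

theorem neg_one_le : neg (one : Term X) ≤ zero :=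
  Le.trans (le_mul (le_one _) (Le.refl _)) (Le.ax (.mul_neg one))

theorem one_le_neg_zero : one ≤ neg (zero : Term X) :=
  Le.trans (Le.ax_symm (.weak_em zero)) (add_le (Le.refl _) (Le.neg_anti (zero_le _)))

/-- The axioms give De Morgan only for binary products; induction over finite subsets, starting from
∼1 = 0, extends it to finite families. -/
theorem neg_prod_le {ι : Type u} [Finite ι] (f : ι → Term X) :
    neg (prod f) ≤ sum fun i => neg (f i) := by
  classical
  have := Fintype.ofFinite ι
  have key (s : Finset ι) : neg (prod fun i : {i // i ∈ s} => f i.1) ≤ sum fun i => neg (f i) := by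
    induction s using Finset.induction_on with
    | empty =>
      refine Le.trans (Le.neg_anti (Le.le_prod fun i => ?_)) (neg_one_le.trans (zero_le _))
      exact absurd i.2 (Finset.notMem_empty _)
    | insert a s _ ih =>
      have h : mul (f a) (prod fun i : {i // i ∈ s} => f i.1) ≤
          prod fun i : {i // i ∈ insert a s} => f i.1 := by
        refine Le.le_prod ?_
        rintro ⟨i, hi⟩
        rcases Finset.mem_insert.1 hi with rfl | hi
        · exact mul_le_left _ _
        · exact (mul_le_right _ _).trans (Le.prod_le (fun i : {i // i ∈ s} => f i.1) ⟨i, hi⟩)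
      exact Le.trans (Le.neg_anti h) (Le.trans (Le.ax (.neg_mul _ _))
        (add_le (Le.le_sum (fun i => neg (f i)) a) ih))
  exact Le.trans (Le.neg_anti (Le.le_prod fun i =>
    Le.prod_le (fun i : {i // i ∈ Finset.univ} => f i.1) ⟨i, Finset.mem_univ i⟩)) (key Finset.univ)

/-- The dual induction. Its base case, ∼0 = 1, comes from weak excluded middle. -/
theorem prod_neg_le {ι : Type u} [Finite ι] (f : ι → Term X) :
    (prod fun i => neg (f i)) ≤ neg (sum f) := by
  classical
  have := Fintype.ofFinite ι
  have key (s : Finset ι) : (prod fun i => neg (f i)) ≤ neg (sum fun i : {i // i ∈ s} => f i.1) := by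
    induction s using Finset.induction_on with
    | empty =>
      refine (le_one _).trans (one_le_neg_zero.trans (Le.neg_anti (Le.sum_le fun i => ?_)))
      exact absurd i.2 (Finset.notMem_empty _)
    | insert a s _ ih =>
      have h : (sum fun i : {i // i ∈ insert a s} => f i.1) ≤
          add (f a) (sum fun i : {i // i ∈ s} => f i.1) := by
        refine Le.sum_le ?_
        rintro ⟨i, hi⟩
        rcases Finset.mem_insert.1 hi with rfl | hi
        · exact le_add_left _ _
        · exact Le.trans (Le.le_sum (fun i : {i // i ∈ s} => f i.1) ⟨i, hi⟩) (le_add_right _ _)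
      exact Le.trans (le_mul (Le.prod_le (fun i => neg (f i)) a) ih)
        (Le.trans (Le.ax_symm (.neg_add _ _)) (Le.neg_anti h))
  exact Le.trans (key Finset.univ) (Le.neg_anti (Le.sum_le fun i =>
    Le.le_sum (fun i : {i // i ∈ Finset.univ} => f i.1) ⟨i, Finset.mem_univ i⟩))

theorem isGenSum_neg_elem (x : X ⊕ X ⊕ X) : IsGenSum (neg (elem x)) := by
  rcases x with l | l | l
  · exact (sumFree_elem (.inr (.inl l))).isGenSum
  · exact (sumFree_elem (.inr (.inr l))).isGenSum
  · exact (sumFree_elem (.inr (.inl l))).isGenSum.congr (Le.ax (.neg_neg_neg _))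
      (Le.ax_symm (.neg_neg_neg _))

theorem isGenSum_neg_gen (i : (X ⊕ X ⊕ X) ⊕ (X ⊕ X ⊕ X) × (X ⊕ X ⊕ X)) :
    IsGenSum (neg (gen i)) := by
  rcases i with x | ⟨x, y⟩
  · exact isGenSum_neg_elem x
  · exact ((isGenSum_neg_elem x).add (isGenSum_neg_elem y)).congr
      (Le.trans (Le.ax (.neg_app _ _)) (Le.ax (.neg_mul _ _)))
      (Le.trans (Le.ax_symm (.neg_mul _ _)) (Le.ax_symm (.neg_app _ _)))

theorem isGenSum_neg_genProd [Finite X]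
    (S : Set ((X ⊕ X ⊕ X) ⊕ (X ⊕ X ⊕ X) × (X ⊕ X ⊕ X))) : IsGenSum (neg (genProd S)) :=
  (IsGenSum.sum fun i : S => isGenSum_neg_gen i.1).congr (neg_prod_le _)
    (Le.sum_le fun i : S => Le.neg_anti (Le.prod_le (fun i : S => gen i.1) i))

/-- With finitely many labels there are finitely many generators, hence finitely many products of
them, so the finite De Morgan laws push negation down to generators. This is the only closure step
that needs finitely many labels. -/
theorem IsGenSum.neg [Finite X] {t : Term X} (h : IsGenSum t) : IsGenSum (neg t) :=
  (IsGenSum.prod fun S : {S // genProd S ≤ t} => isGenSum_neg_genProd S.1).congr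
    (Le.le_prod fun S => Le.neg_anti S.2) (Le.trans (prod_neg_le _) (Le.neg_anti h))

/-- Over finitely many labels, every term is a sum of products of generators. -/
theorem isGenSum [Finite X] (t : Term X) : IsGenSum t := by
  induction t with
  | label l => exact (sumFree_elem (.inl l)).isGenSum
  | prod _ ih => exact .prod ih
  | sum _ ih => exact .sum ih
  | app _ _ h k => exact h.app k
  | neg _ h => exact h.neg

end Term

/-- Over finitely many labels there are only finitely many causal values. -/
instance Value.finite {X : Type u} [Finite X] : Finite (Value X) := by
  refine Finite.of_injective
    -- By the normal form a value is determined by the set of generator products below it, and there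
    -- are finitely many such sets.
    (fun v : Value X => {S | Value.mk (Term.genProd S) ≤ v}) ?_
  have key (v w : Value X) (h : {S | Value.mk (Term.genProd S) ≤ v} =
      {S | Value.mk (Term.genProd S) ≤ w}) : v ≤ w := by
    induction v using Quotient.inductionOn with | _ t
    induction w using Quotient.inductionOn with | _ w
    exact Term.isGenSum_iff.1 t.isGenSum w fun S hS => (Set.ext_iff.1 h S).1 hS
  exact fun v w h => le_antisymm (key v w h) (key w v h.symm)

/-! ### Flattening as a homomorphism with a right adjoint -/

namespace PTerm

variable {X : Type u}

/-- A provenance term, read as a causal term without application. -/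
def toTerm : PTerm X → Term X
  | label l => .label l
  | prod f => .prod fun i => (f i).toTerm
  | sum f => .sum fun i => (f i).toTerm
  | neg t => .neg t.toTerm

theorem toP_toTerm (t : PTerm X) : t.toTerm.toP = t := by
  induction t with
  | label => rfl
  | prod _ ih => simp only [toTerm, Term.toP, ih]
  | sum _ ih => simp only [toTerm, Term.toP, ih]
  | neg _ ih => simp only [toTerm, Term.toP, ih]

end PTerm

section LambdaP

variable {X : Type u}

theorem lambdaP_surjective : Function.Surjective (lambdaP : Value X → PValue X) := by
  rintro ⟨t⟩
  exact ⟨Value.mk t.toTerm, congrArg PValue.mk t.toP_toTerm⟩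

instance PValue.finite [Finite X] : Finite (PValue X) := Finite.of_surjective _ lambdaP_surjective

theorem lambdaP_inf (a b : Value X) : lambdaP (a ⊓ b) = lambdaP a ⊓ lambdaP b := by
  induction a, b using Quotient.inductionOn₂ with | _ t w
  exact Term.pv_mul t w

theorem lambdaP_sup (a b : Value X) : lambdaP (a ⊔ b) = lambdaP a ⊔ lambdaP b := by
  induction a, b using Quotient.inductionOn₂ with | _ t w
  exact Term.pv_add t w

theorem lambdaP_top : lambdaP (⊤ : Value X) = ⊤ := Term.pv_one

theorem lambdaP_bot : lambdaP (⊥ : Value X) = ⊥ := Term.pv_zero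

theorem lambdaP_compl (a : Value X) : lambdaP aᶜ = (lambdaP a)ᶜ := by
  induction a using Quotient.inductionOn with | _ t
  exact Term.pv_neg t

theorem lambdaP_app (a b : Value X) : lambdaP (a.app b) = lambdaP a ⊓ lambdaP b := by
  induction a, b using Quotient.inductionOn₂ with | _ t w
  exact Term.pv_app t w

theorem Value.compl_antitone : Antitone (compl : Value X → Value X) := by
  intro a b
  induction a, b using Quotient.inductionOn₂ with | _ t w
  exact Term.Le.neg_anti

theorem Value.app_mono {a a' b b' : Value X} (h : a ≤ a') (k : b ≤ b') : a.app b ≤ a'.app b' := by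
  induction a, a' using Quotient.inductionOn₂ with | _ t t'
  induction b, b' using Quotient.inductionOn₂ with | _ w w'
  exact Term.Le.app_mono h k

/-- The adjoint sends x to the join of all v with `lambdaP v ≤ x`. This join is finite and `lambdaP`
preserves it, so it is itself such a v. -/
theorem exists_gc_lambdaP [Finite X] :
    ∃ ρ : PValue X → Value X, GaloisConnection lambdaP ρ := by
  classical
  have := Fintype.ofFinite (Value X)
  have hmono : Monotone (lambdaP : Value X → PValue X) := fun a b h => by
    rw [← inf_eq_left, ← lambdaP_inf, inf_eq_left.2 h]
  refine ⟨fun x => (Finset.univ.filter fun v => lambdaP v ≤ x).sup id, fun v x => ⟨fun h => ?_,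
    fun h => (hmono h).trans ?_⟩⟩
  · exact Finset.le_sup (f := id) (Finset.mem_filter.2 ⟨Finset.mem_univ v, h⟩)
  · rw [Finset.apply_sup_eq_sup_comp lambdaP lambdaP_sup lambdaP_bot]
    exact Finset.sup_le fun v hv => (Finset.mem_filter.1 hv).2

end LambdaP

/-! ### Monotonicity of reducts -/

section Semantics

variable {At V : Type*} [Lattice V]

theorem foldr_inf_le [OrderTop V] {α : Type*} {f g : α → V} {l : List α}
    (h : ∀ a ∈ l, f a ≤ g a) :
    (l.map f).foldr (· ⊓ ·) ⊤ ≤ (l.map g).foldr (· ⊓ ·) ⊤ := by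
  induction l with
  | nil => exact le_rfl
  | cons a l ih =>
    exact inf_le_inf (h a (by simp)) (ih fun b hb => h b (by simp [hb]))

theorem litValue_mono {I I' : At → V} (h : I ≤ I') (c : At ⊕ V) :
    litValue I c ≤ litValue I' c := by
  rcases c with A | v
  · exact h A
  · exact le_rfl

variable [OrderTop V] [Compl V]

/-- The value of the body of the reduct of `r` by `J`. -/
theorem bodyValue_reduct (I J : At → V) (r : Rule At V V) :
    bodyValue I { r with
      pos := r.pos ++ r.neg.map fun c => Sum.inr (litValue J c)ᶜ
      neg := [] } =
    (r.pos.map (litValue I)).foldr (· ⊓ ·) ⊤ ⊓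
      (r.neg.map fun c => (litValue J c)ᶜ).foldr (· ⊓ ·) ⊤ := by
  -- Folding over the appended body starts the positive part from the value of the negative part;
  -- this separates the two.
  have h (l : List V) (b : V) : l.foldr (· ⊓ ·) b = l.foldr (· ⊓ ·) ⊤ ⊓ b := by
    induction l with
    | nil => simp
    | cons a l ih => rw [List.foldr_cons, ih, List.foldr_cons, inf_assoc]
  simp only [bodyValue, List.map_append, List.foldr_append, List.map_nil, List.foldr_nil,
    inf_top_eq, List.map_map]
  rw [h]
  rfl

theorem isModel_reduct_iff {step : V → V → V} {P : Set (Rule At V V)} {I J : At → V} :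
    IsModel step (reduct P J) I ↔ ∀ r ∈ P,
      step ((r.pos.map (litValue I)).foldr (· ⊓ ·) ⊤ ⊓
        (r.neg.map fun c => (litValue J c)ᶜ).foldr (· ⊓ ·) ⊤) r.label ≤ I r.head := by
  simp only [IsModel, reduct, Set.forall_mem_image, bodyValue_reduct]

/-- A larger `J` lowers the negated values, hence the rule bodies, so the reduct becomes easier to
satisfy. -/
theorem IsModel.mono {step : V → V → V} (hstep : ∀ c, Monotone fun b => step b c)
    (hc : Antitone (compl : V → V)) {P : Set (Rule At V V)} {I J J' : At → V} (h : J ≤ J')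
    (hI : IsModel step (reduct P J) I) : IsModel step (reduct P J') I :=
  isModel_reduct_iff.2 fun r hr => le_trans
    (hstep _ (inf_le_inf_left _ (foldr_inf_le fun c _ => hc (litValue_mono h c))))
    (isModel_reduct_iff.1 hI r hr)

theorem IsGamma.antitone {step : V → V → V} (hstep : ∀ c, Monotone fun b => step b c)
    (hc : Antitone (compl : V → V)) {P : Set (Rule At V V)} {J J' G G' : At → V} (h : J ≤ J')
    (hG : IsGamma step P J G) (hG' : IsGamma step P J' G') : G' ≤ G :=
  hG'.2 (IsModel.mono hstep hc h hG.1)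

end Semantics

/-! ### Existence of least models and of the alternating fixpoint -/

section Existence

variable {At V : Type*} [CompleteLattice V] [Compl V] {step : V → V → V}
  (hstep : ∀ c, Monotone fun b => step b c) (hc : Antitone (compl : V → V))
  (P : Set (Rule At V V))
include hstep

/-- Bodies of a reduct are monotone in the interpretation, so the pointwise infimum of all models is
again a model. -/
theorem exists_isGamma (J : At → V) : ∃ G, IsGamma step P J G := by
  refine ⟨sInf {I | IsModel step (reduct P J) I}, ?_, fun _ h => sInf_le h⟩
  refine isModel_reduct_iff.2 fun r hr => ?_
  have h (I : At → V) (hI : IsModel step (reduct P J) I) :=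
    le_trans (hstep r.label (inf_le_inf_right _ (foldr_inf_le (l := r.pos) fun c _ =>
      litValue_mono (sInf_le (show I ∈ {I | IsModel step (reduct P J) I} from hI)) c)))
      (isModel_reduct_iff.1 hI r hr)
  rw [sInf_apply]
  exact le_iInf fun I => h I.1 I.2

include hc

/-- The least fixpoint of `Γ²` exists and lies below all its prefixpoints. -/
theorem exists_isLfpGammaSq : ∃ L, IsLfpGammaSq step P L ∧
    ∀ I J K, IsGamma step P I J → IsGamma step P J K → K ≤ I → L ≤ I := by
  choose Γ hΓ using exists_isGamma hstep P
  have anti {J J' : At → V} (h : J ≤ J') : Γ J' ≤ Γ J := (hΓ J).antitone hstep hc h (hΓ J')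
  -- The square of an antitone operator is monotone, so Knaster–Tarski applies and gives leastness
  -- among prefixpoints as well.
  let F : (At → V) →o (At → V) := ⟨fun I => Γ (Γ I), fun _ _ h => anti (anti h)⟩
  have key (I J K) (h : IsGamma step P I J) (k : IsGamma step P J K) (hK : K ≤ I) :
      F.lfp ≤ I := by
    obtain rfl := h.unique (hΓ I)
    obtain rfl := k.unique (hΓ _)
    exact F.lfp_le hK
  refine ⟨F.lfp, ⟨⟨Γ F.lfp, hΓ _, ?_⟩, fun I => fun ⟨J, h, k⟩ => key I J I h k le_rfl⟩, key⟩
  have h := hΓ (Γ F.lfp)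
  rwa [show Γ (Γ F.lfp) = F.lfp from F.map_lfp] at h

end Existence

section FiniteExistence

variable {At V : Type*} [Lattice V] [BoundedOrder V] [Finite V] [Compl V] {step : V → V → V}
  (hstep : ∀ c, Monotone fun b => step b c) (hc : Antitone (compl : V → V))
  (P : Set (Rule At V V))
include hstep

/-- A finite bounded lattice is complete for the order it already has. -/
theorem exists_isGamma_of_finite (J : At → V) : ∃ G, IsGamma step P J G := by
  have := Fintype.ofFinite V
  let := Fintype.toCompleteLattice V
  exact exists_isGamma hstep P J

include hc

theorem exists_isLfpGammaSq_of_finite : ∃ L, IsLfpGammaSq step P L ∧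
    ∀ I J K, IsGamma step P I J → IsGamma step P J K → K ≤ I → L ≤ I := by
  have := Fintype.ofFinite V
  let := Fintype.toCompleteLattice V
  exact exists_isLfpGammaSq hstep hc P

end FiniteExistence

/-! ### Transfer of least models and least fixpoints along flattening -/

section Transfer

variable {At X : Type u}

theorem lambdaP_foldr (l : List (Value X)) :
    lambdaP (l.foldr (· ⊓ ·) ⊤) = (l.map lambdaP).foldr (· ⊓ ·) ⊤ := by
  induction l with
  | nil => exact lambdaP_top
  | cons a l ih => rw [List.foldr_cons, lambdaP_inf, ih]; rfl

theorem litValue_map (I : At → Value X) (c : At ⊕ Value X) :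
    litValue (lambdaP ∘ I) (c.map id lambdaP) = lambdaP (litValue I c) := by
  cases c <;> rfl

theorem lambdaP_step (I J : At → Value X) (r : Rule At (Value X) (Value X)) :
    lambdaP (Value.app ((r.pos.map (litValue I)).foldr (· ⊓ ·) ⊤ ⊓
        (r.neg.map fun c => (litValue J c)ᶜ).foldr (· ⊓ ·) ⊤) r.label) =
      (((r.map lambdaP lambdaP).pos.map (litValue (lambdaP ∘ I))).foldr (· ⊓ ·) ⊤ ⊓
        ((r.map lambdaP lambdaP).neg.map
          fun c => (litValue (lambdaP ∘ J) c)ᶜ).foldr (· ⊓ ·) ⊤) ⊓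
        (r.map lambdaP lambdaP).label := by
  simp only [lambdaP_app, lambdaP_inf, lambdaP_foldr, Rule.map, List.map_map, Function.comp_def]
  congr 5
  · exact funext fun c => (litValue_map I c).symm
  · exact funext fun c => (lambdaP_compl _).trans (congrArg compl (litValue_map J c).symm)

variable [Finite X]

/-- Flattening commutes with the operator `Γ`. -/
theorem IsGamma.lambdaP {P : Set (Rule At (Value X) (Value X))} {J G : At → Value X}
    (h : IsGamma Value.app P J G) :
    IsGamma (· ⊓ ·) (Rule.map lambdaP lambdaP '' P) (lambdaP ∘ J) (lambdaP ∘ G) := by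
  obtain ⟨ρ, gc⟩ := exists_gc_lambdaP (X := X)
  constructor
  · refine isModel_reduct_iff.2 (Set.forall_mem_image.2 fun r hr => ?_)
    exact (lambdaP_step G J r).symm.trans_le (gc.monotone_l (isModel_reduct_iff.1 h.1 r hr))
  · intro I' hI' A
    have hρ : IsModel Value.app (reduct P J) (ρ ∘ I') → G ≤ ρ ∘ I' := fun k => h.2 k
    -- The pullback `ρ ∘ I'` is a model on the causal side: by adjunction each rule may be checked
    -- after flattening. There the negative part agrees with the flattened reduct, and the positive
    -- part only shrinks because `lambdaP ∘ ρ` lies below the identity.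
    refine (gc _ _).2 (hρ (isModel_reduct_iff.2 fun r hr => (gc _ _).1 ?_) A)
    rw [lambdaP_step]
    refine le_trans ?_ (isModel_reduct_iff.1 hI' _ (Set.mem_image_of_mem _ hr))
    exact inf_le_inf_right _ (inf_le_inf_right _
      (foldr_inf_le fun c _ => litValue_mono (fun A => gc.l_u_le (I' A)) c))

/-- Flattening commutes with the least fixpoint of `Γ²`. -/
theorem IsLfpGammaSq.lambdaP {P : Set (Rule At (Value X) (Value X))} {L : At → Value X}
    (h : IsLfpGammaSq Value.app P L) :
    IsLfpGammaSq (· ⊓ ·) (Rule.map lambdaP lambdaP '' P) (lambdaP ∘ L) := by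
  obtain ⟨ρ, gc⟩ := exists_gc_lambdaP (X := X)
  have hstep (c : Value X) : Monotone fun b => Value.app b c := fun _ _ k => Value.app_mono k le_rfl
  constructor
  · obtain ⟨J, h₁, h₂⟩ := h.1
    exact ⟨_, h₁.lambdaP, h₂.lambdaP⟩
  · rintro I' ⟨J', h₁, h₂⟩ A
    obtain ⟨L', hL', key⟩ := exists_isLfpGammaSq_of_finite hstep Value.compl_antitone P
    obtain rfl := hL'.unique h
    -- `ρ ∘ I'` is shown to be a prefixpoint of `Γ²`; it need not be a fixpoint, which is why `key`
    -- is used rather than the leastness in `h`. Two antitone comparisons give `lambdaP ∘ K ≤ I'`,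
    -- that is, `K ≤ ρ ∘ I'`.
    obtain ⟨J, hJ⟩ := exists_isGamma_of_finite hstep P (ρ ∘ I')
    obtain ⟨K, hK⟩ := exists_isGamma_of_finite hstep P J
    have hstep' (c : PValue X) : Monotone fun b => b ⊓ c := fun _ _ k => inf_le_inf_right c k
    have hc' : Antitone (compl : PValue X → PValue X) := compl_anti
    have k₁ : J' ≤ ECJ.lambdaP ∘ J :=
      hJ.lambdaP.antitone hstep' hc' (fun A => gc.l_u_le (I' A)) h₁
    have k₂ : ECJ.lambdaP ∘ K ≤ I' := h₂.antitone hstep' hc' k₁ hK.lambdaP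
    exact (gc _ _).2 (key _ J K hJ hK (fun A => (gc _ _).1 (k₂ A)) A)

end Transfer

/-! ### The augmented programs and the two models -/

/-- Flattening the augmented causal program gives the why-not program. -/
theorem map_lambdaP_causalAug {At Lb : Type u} (P : Program At Lb) :
    Rule.map lambdaP lambdaP '' causalAug P = whyNotAug P := by
  rw [causalAug, whyNotAug, Set.image_union, Set.image_image]
  congr 1
  · refine Set.image_congr fun r _ => ?_
    rcases r with ⟨l, A, p, n⟩
    simp only [Rule.map, List.map_map, Sum.map_comp_map, Function.comp_id]
    congr 1
    cases l
    · exact lambdaP_top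
    · rfl
  · ext ⟨l, A, p, n⟩
    constructor
    · rintro ⟨⟨l, A, p, n⟩, ⟨⟨h₁, h₂⟩, h₃, h₄⟩, h⟩
      simp only at h₁ h₂ h₄
      subst h₁ h₂ h₄
      cases h
      exact ⟨⟨rfl, rfl⟩, h₃, lambdaP_compl (Value.mk (.label (XLabel.notFact A)))⟩
    · rintro ⟨⟨h₁, h₂⟩, h₃, h₄⟩
      simp only at h₁ h₂ h₄
      subst h₁ h₂ h₄
      refine ⟨⟨(Value.mk (.label (.notFact A)))ᶜ, A, [], []⟩, ⟨⟨rfl, rfl⟩, h₃, rfl⟩, ?_⟩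
      simp only [Rule.map, lambdaP_compl]
      rfl

instance XLabel.finite {At Lb : Type u} [Finite At] [Finite Lb] : Finite (XLabel At Lb) :=
  Finite.of_surjective (Sum.elim XLabel.lab XLabel.notFact : Lb ⊕ At → XLabel At Lb) fun
    | .lab l => ⟨.inl l, rfl⟩
    | .notFact A => ⟨.inr A, rfl⟩

theorem IsCausalWFM.unique {At X : Type u} {P : Set (Rule At (Value X) (Value X))}
    {W W' : QLit At → Value X} (h : IsCausalWFM P W) (h' : IsCausalWFM P W') : W = W' := by
  obtain ⟨L, U, hL, hU, h⟩ := h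
  obtain ⟨L', U', hL', hU', h'⟩ := h'
  obtain rfl := hL.unique hL'
  obtain rfl := hU.unique hU'
  funext q
  cases q with
  | atom A => rw [(h A).1, (h' A).1]
  | not A => rw [(h A).2.1, (h' A).2.1]
  | undef A => rw [(h A).2.2, (h' A).2.2, (h A).1, (h' A).1, (h A).2.1, (h' A).2.1]

theorem IsWhyNotProvenance.unique {At Lb : Type u} {P : Program At Lb}
    {D D' : QLit At → PValue (XLabel At Lb)} (h : IsWhyNotProvenance P D)
    (h' : IsWhyNotProvenance P D') : D = D' := by
  obtain ⟨L, U, hL, hU, h⟩ := h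
  obtain ⟨L', U', hL', hU', h'⟩ := h'
  obtain rfl := hL.unique hL'
  obtain rfl := hU.unique hU'
  funext q
  cases q with
  | atom A => rw [(h A).1, (h' A).1]
  | not A => rw [(h A).2.1, (h' A).2.1]
  | undef A => rw [(h A).2.2, (h' A).2.2]

theorem exists_isCausalWFM {At X : Type u} [Finite X] (P : Set (Rule At (Value X) (Value X))) :
    ∃ W, IsCausalWFM P W := by
  have hstep (c : Value X) : Monotone fun b => Value.app b c := fun _ _ k => Value.app_mono k le_rfl
  obtain ⟨L, hL, -⟩ := exists_isLfpGammaSq_of_finite hstep Value.compl_antitone P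
  obtain ⟨U, hU⟩ := exists_isGamma_of_finite hstep P L
  exact ⟨fun
    | .atom A => L A
    | .not A => (U A)ᶜ
    | .undef A => (L A)ᶜ ⊓ (U A)ᶜᶜ, L, U, hL, hU, fun _ => ⟨rfl, rfl, rfl⟩⟩

/-- Flattening the causal well-founded model gives the why-not provenance. -/
theorem IsCausalWFM.isWhyNotProvenance {At Lb : Type u} [Finite At] [Finite Lb]
    {P : Program At Lb} {W : QLit At → Value (XLabel At Lb)} (h : IsCausalWFM (causalAug P) W) :
    IsWhyNotProvenance P (lambdaP ∘ W) := by
  obtain ⟨L, U, hL, hU, h⟩ := h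
  refine ⟨lambdaP ∘ L, lambdaP ∘ U, map_lambdaP_causalAug P ▸ hL.lambdaP,
    map_lambdaP_causalAug P ▸ hU.lambdaP, fun A => ?_⟩
  obtain ⟨h₁, h₂, h₃⟩ := h A
  simp only [Function.comp_apply]
  refine ⟨by rw [h₁], by rw [h₂, lambdaP_compl], ?_⟩
  -- The causal value is ∼L*∼∼U; the double negation is cancelled only after flattening, in the
  -- Boolean algebra.
  rw [h₃, h₁, h₂, lambdaP_inf, lambdaP_compl, lambdaP_compl, lambdaP_compl, compl_compl]

end ECJ

theorem mainTheorem6 {At Lb : Type u} [Finite At] [Finite Lb] (P : ECJ.Program At Lb) :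
    (∃! W, ECJ.IsCausalWFM (ECJ.causalAug P) W) ∧
    (∃! D, ECJ.IsWhyNotProvenance P D) ∧
    ∀ W D, ECJ.IsCausalWFM (ECJ.causalAug P) W → ECJ.IsWhyNotProvenance P D →
      ∀ L : ECJ.QLit At, ECJ.lambdaP (W L) = D L := by
  obtain ⟨W, hW⟩ := ECJ.exists_isCausalWFM (ECJ.causalAug P)
  -- The flattened causal model serves as the witness for the why-not provenance, so the final
  -- equality is an instance of uniqueness.
  exact ⟨⟨W, hW, fun _ h => h.unique hW⟩, ⟨_, hW.isWhyNotProvenance, fun _ h =>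
    h.unique hW.isWhyNotProvenance⟩, fun _ _ h k => congrFun (h.isWhyNotProvenance.unique k)⟩
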